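/- Let $R$ be a commutative ring with identity (not necessarily Noetherian) and let $M$ be a finitely generated $R$-module. For a finite sequence $\underline{x}=x_1,\dots,x_r$ in $R$ with Koszul complex $\mathbb{K}_\bullet(\underline{x})$, the Koszul grade of $\underline{x}$ on $M$ is $\inf\{i\ge 0 : H^i(\operatorname{Hom}_R(\mathbb{K}_\bullet(\underline{x}),M))\neq 0\}$ (with $\inf\emptyset=+\infty$); it depends only on the ideal generated by $\underline{x}$. For an ideal $\mathfrak{a}$ of $R$, the Koszul grade $\operatorname{K.grade}_R(\mathfrak{a},M)$ is the supremum of the Koszul grades on $M$ of the finite sequences of elements of $\mathfrak{a}$, that is, of the Koszul grades of the finitely generated ideals contained in $\mathfrak{a}$. The $M$-height of $\mathfrak{a}$ is $\operatorname{ht}_M(\mathfrak{a})=\inf\{\dim M_{\mathfrak{p}} : \mathfrak{p}\in\operatorname{Supp}_R(M),\ \mathfrak{a}\subseteq\mathfrak{p}\}$ (with $\inf\emptyset=+\infty$), where $\dim M_{\mathfrak p}$ is the supremum of the lengths of chains of primes in $\operatorname{Supp}_R(M)$ with largest member $\mathfrak p$. Consider the following conditions: (i) $\operatorname{ht}_M(\mathfrak{p})=\operatorname{K.grade}_R(\mathfrak{p},M)$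 for all prime ideals $\mathfrak{p}\in\operatorname{Supp}_R(M)$. (ii) $\operatorname{ht}_M(\mathfrak{a})=\operatorname{K.grade}_R(\mathfrak{a},M)$ for all ideals $\mathfrak{a}$ of $R$. (iii) $\operatorname{ht}_M(\mathfrak{q})=\operatorname{K.grade}_{R_{\mathfrak{p}}}(\mathfrak{q}R_{\mathfrak{p}},M_{\mathfrak{p}})$ for all prime ideals $\mathfrak{p},\mathfrak{q}\in\operatorname{Supp}_R(M)$ with $\mathfrak{q}\subseteq\mathfrak{p}$. (iv) $\operatorname{ht}_M(\mathfrak{p})=\operatorname{K.grade}_{R_{\mathfrak{p}}}(\mathfrak{p}R_{\mathfrak{p}},M_{\mathfrak{p}})$ for all prime ideals $\mathfrak{p}\in\operatorname{Supp}_R(M)$. (v) $\operatorname{ht}_M(\mathfrak{a})=\operatorname{K.grade}_R(\mathfrak{a},M)$ for all finitely generated ideals $\mathfrak{a}$ of $R$. Then $(i)\Leftrightarrow(ii)\Rightarrow(iii)\Rightarrow(iv)\Rightarrow(v)$. -/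

import Mathlib

universe u v

noncomputable section

section Koszul

variable {R : Type u} [CommRing R] {r : ℕ}

/-- The linear form `R ^ r → R`, `e_j ↦ x_j`. -/
def koszulForm (x : Fin r → R) : (Fin r → R) →ₗ[R] R :=
  Fintype.linearCombination R x

/-- The differential `⋀^(n+1) R^r → ⋀^n R^r` of the Koszul complex `K_•(x)`:
`v_0 ∧ ⋯ ∧ v_n ↦ ∑ j, (-1)^j φ(v_j) v_0 ∧ ⋯ ∧ v̂_j ∧ ⋯ ∧ v_n`, where `φ(e_j) = x_j`. -/
def koszulDifferential (x : Fin r → R) (n : ℕ) :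
    ⋀[R]^(n + 1) (Fin r → R) →ₗ[R] ⋀[R]^n (Fin r → R) :=
  exteriorPower.alternatingMapLinearEquiv
    (AlternatingMap.alternatizeUncurryFin
      ((koszulForm x).smulRight (exteriorPower.ιMulti R n (M := Fin r → R))))

theorem koszulDifferential_ιMulti (x : Fin r → R) (n : ℕ) (w : Fin (n + 1) → Fin r → R) :
    koszulDifferential x n (exteriorPower.ιMulti R (n + 1) w) =
      ∑ j : Fin (n + 1), (-1 : ℤ) ^ (j : ℕ) •
        (koszulForm x (w j) • exteriorPower.ιMulti R n (j.removeNth w)) := by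
  simp [koszulDifferential, AlternatingMap.alternatizeUncurryFin_apply]

/-- The Koszul differentials form a complex. -/
theorem koszulDifferential_comp (x : Fin r → R) (n : ℕ) :
    koszulDifferential x n ∘ₗ koszulDifferential x (n + 1) = 0 := by
  apply exteriorPower.linearMap_ext
  have h := AlternatingMap.alternatizeUncurryFin_alternatizeUncurryFinLM_comp_of_symmetric
    (f := (koszulForm x).smulRight
      ((koszulForm x).smulRight (exteriorPower.ιMulti R n (M := Fin r → R))))
    (fun a b => by ext w; simp [smul_smul, mul_comm])
  ext1 w
  have hw := congrArg (fun g => g w) h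
  simp [koszulDifferential, AlternatingMap.alternatizeUncurryFin_apply] at hw ⊢
  simpa using hw

variable (M : Type v) [AddCommGroup M] [Module R M]

/-- The cocycles of degree `n` of `Hom_R(K_•(x), M)`. -/
def koszulCocycles (x : Fin r → R) (n : ℕ) : Submodule R (⋀[R]^n (Fin r → R) →ₗ[R] M) :=
  LinearMap.ker (LinearMap.lcomp R M (koszulDifferential x n))

/-- The coboundaries of degree `n` of `Hom_R(K_•(x), M)`. -/
def koszulCoboundaries (x : Fin r → R) :
    (n : ℕ) → Submodule R (⋀[R]^n (Fin r → R) →ₗ[R] M)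
  | 0 => ⊥
  | n + 1 => LinearMap.range (LinearMap.lcomp R M (koszulDifferential x n))

/-- The Koszul cohomology module `H^n(Hom_R(K_•(x), M))`. -/
abbrev KoszulCohomology (x : Fin r → R) (n : ℕ) : Type (max u v) :=
  koszulCocycles M x n ⧸ (koszulCoboundaries M x n).submoduleOf (koszulCocycles M x n)

/-- `inf {n | H^n(Hom_R(K_•(x), M)) ≠ 0}`, with `inf ∅ = ∞`. -/
def koszulGradeSeq (x : Fin r → R) : ℕ∞ :=
  ⨅ (n : ℕ) (_ : Nontrivial (KoszulCohomology M x n)), (n : ℕ∞)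

end Koszul

/-- The Koszul grade `K.grade_R(a, M)` of an arbitrary ideal: the supremum, over all finitely
generated ideals `b ⊆ a`, of the Koszul grade of a finite sequence generating `b`. A finite
sequence of elements of `a` is the same as a generating sequence of some such `b`. -/
def koszulGrade {R : Type u} [CommRing R] (a : Ideal R)
    (M : Type v) [AddCommGroup M] [Module R M] : ℕ∞ :=
  ⨆ (r : ℕ) (x : Fin r → R) (_ : ∀ j, x j ∈ a), koszulGradeSeq M x

/-- The `M`-height `ht_M(a) = inf {dim M_p | p ∈ V(a) ∩ Supp M}`, with `inf ∅ = ∞`. Here `dim M_p`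
is the supremum of the lengths of chains of primes in `Supp M` with largest member `p`. -/
def moduleHeight {R : Type u} [CommRing R] (M : Type v) [AddCommGroup M] [Module R M]
    (a : Ideal R) : ℕ∞ :=
  ⨅ (p : Module.support R M) (_ : a ≤ p.1.asIdeal), Order.height p

section Conditions

variable (R : Type u) [CommRing R] (M : Type v) [AddCommGroup M] [Module R M]

/-- `ht_M(p) = K.grade_R(p, M)` for all primes `p ∈ Supp M`. -/
def IsCMSpec : Prop :=
  ∀ p ∈ Module.support R M, moduleHeight M p.asIdeal = koszulGrade p.asIdeal M

/-- `ht_M(a) = K.grade_R(a, M)` for all ideals `a`. -/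
def IsCMIdeals : Prop :=
  ∀ a : Ideal R, moduleHeight M a = koszulGrade a M

/-- `ht_M(q) = K.grade_{R_p}(qR_p, M_p)` for all primes `q ⊆ p` in `Supp M`. -/
def IsCMLocal : Prop :=
  ∀ p ∈ Module.support R M, ∀ q ∈ Module.support R M, q.asIdeal ≤ p.asIdeal →
    moduleHeight M q.asIdeal =
      koszulGrade (q.asIdeal.map (algebraMap R (Localization.AtPrime p.asIdeal)))
        (LocalizedModule p.asIdeal.primeCompl M)

/-- `ht_M(p) = K.grade_{R_p}(pR_p, M_p)` for all primes `p ∈ Supp M`. -/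
def IsCMGlaz : Prop :=
  ∀ p ∈ Module.support R M,
    moduleHeight M p.asIdeal =
      koszulGrade (p.asIdeal.map (algebraMap R (Localization.AtPrime p.asIdeal)))
        (LocalizedModule p.asIdeal.primeCompl M)

/-- `ht_M(a) = K.grade_R(a, M)` for all finitely generated ideals `a`. -/
def IsCMFGIdeals : Prop :=
  ∀ a : Ideal R, a.FG → moduleHeight M a = koszulGrade a M

end Conditions

end

/-! Everything rests on following one cohomology class. Let `g` be the Koszul grade of `x`, `F` a
nonzero class in degree `g`, and `T` a set of elements acting nilpotently on it. Adjoining an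
element of `T` to the sequence keeps cohomology zero below `g` and keeps such a class in degree `g`
(`HasNilpotentClass.snoc`), so every finite sequence `y` in `T` has grade at most `g`
(`HasNilpotentClass.koszulGradeSeq_le`). Monotonicity up to radical and modulo the annihilator
follows, as does the estimate for products of ideals.

Grade is always at most height. After localizing at a prime of the support of finite height `d`,
Kronecker's theorem encloses a given sequence, modulo the annihilator and up to radical, in an ideal
with `d` generators; by Nakayama their top Koszul cohomology is nonzero, so the grade is at most
`d`.

For (i) ⇒ (ii), an ideal maximal among those of grade at most `g` is a prime of the support
(`exists_prime_koszulGrade_le`), which bounds the height from above. For (ii) ⇒ (iii), the grade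
does not drop and the height does not grow under localization. For (iv) ⇒ (v), localize a nonzero
class in the lowest degree at a minimal prime `p` of its annihilator: the maximal ideal acts
nilpotently on it, so the grade of `pR_p` is at most that of the ideal
(`hasNilpotentClass_localization`). The implications (ii) ⇒ (i) and (iii) ⇒ (iv) are
specializations. -/

noncomputable section

/-! ### Koszul cochains as alternating forms, and adjoining one element to a sequence -/

section KoszulForms

open AlternatingMap

variable {R : Type*} [CommRing R] {V W N : Type*} [AddCommGroup V] [Module R V]
  [AddCommGroup W] [Module R W] [AddCommGroup N] [Module R N] {n : ℕ}

/-- The Koszul differential `F ↦ φ ∧ F` on `N`-valued alternating maps on `V`. -/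
def koszulD (φ : V →ₗ[R] R) (n : ℕ) :
    (V [⋀^Fin n]→ₗ[R] N) →ₗ[R] (V [⋀^Fin (n + 1)]→ₗ[R] N) where
  toFun F := alternatizeUncurryFin (φ.smulRight F)
  map_add' F G := by
    ext w; simp [alternatizeUncurryFin_apply, Finset.sum_add_distrib]
  map_smul' c F := by
    ext w; simp [alternatizeUncurryFin_apply, Finset.smul_sum, smul_comm _ c]

theorem koszulD_apply (φ : V →ₗ[R] R) (F : V [⋀^Fin n]→ₗ[R] N) (w : Fin (n + 1) → V) :
    koszulD φ n F w = ∑ j : Fin (n + 1), (-1 : ℤ) ^ (j : ℕ) • (φ (w j) • F (j.removeNth w)) := by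
  simp [koszulD, alternatizeUncurryFin_apply]

/-- Contraction is a homotopy between multiplication by `φ v` and zero, in degree zero. -/
theorem curryLeft_koszulD_zero (φ : V →ₗ[R] R) (F : V [⋀^Fin 0]→ₗ[R] N) (v : V) :
    (koszulD φ 0 F).curryLeft v = φ v • F := by
  ext w
  simp only [curryLeft_apply_apply, koszulD_apply, AlternatingMap.smul_apply]
  simp

/-- Contraction is a homotopy between multiplication by `φ v` and zero. -/
theorem curryLeft_koszulD (φ : V →ₗ[R] R) (F : V [⋀^Fin (n + 1)]→ₗ[R] N) (v : V) :
    (koszulD φ (n + 1) F).curryLeft v = φ v • F - koszulD φ n (F.curryLeft v) := by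
  ext w
  simp only [curryLeft_apply_apply, koszulD_apply, AlternatingMap.smul_apply,
    AlternatingMap.sub_apply]
  rw [Fin.sum_univ_succ, sub_eq_add_neg, ← Finset.sum_neg_distrib]
  congr 1
  · simp [Matrix.vecCons]
  · refine Finset.sum_congr rfl fun j _ => ?_
    have : j.succ.removeNth (Matrix.vecCons v w) = Matrix.vecCons v (j.removeNth w) := by
      funext i
      refine Fin.cases ?_ (fun i => ?_) i <;> simp [Fin.removeNth, Matrix.vecCons]
    rw [this]
    simp [pow_succ]

theorem koszulD_compLinearMap (φ : V →ₗ[R] R) (f : W →ₗ[R] V) (F : V [⋀^Fin n]→ₗ[R] N) :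
    koszulD (φ ∘ₗ f) n (F.compLinearMap f) = (koszulD φ n F).compLinearMap f := by
  ext w
  simp only [koszulD_apply, compLinearMap_apply, LinearMap.comp_apply]
  rfl

theorem koszulD_zero_form (F : V [⋀^Fin n]→ₗ[R] N) : koszulD (0 : V →ₗ[R] R) n F = 0 := by
  ext w
  simp [koszulD_apply]

variable (N) in
/-- The coboundaries of degree `n`. -/
def koszulB (φ : V →ₗ[R] R) : (n : ℕ) → Submodule R (V [⋀^Fin n]→ₗ[R] N)
  | 0 => ⊥
  | n + 1 => LinearMap.range (koszulD φ n)

theorem mem_koszulB_zero {φ : V →ₗ[R] R} {F : V [⋀^Fin 0]→ₗ[R] N} :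
    F ∈ koszulB N φ 0 ↔ F = 0 := Submodule.mem_bot R

theorem mem_koszulB_succ {φ : V →ₗ[R] R} {F : V [⋀^Fin (n + 1)]→ₗ[R] N} :
    F ∈ koszulB N φ (n + 1) ↔ ∃ G, koszulD φ n G = F := Iff.rfl

variable (N) in
/-- Vanishing of the degree `n` Koszul cohomology of `φ` with values in `N`. -/
def KoszulExactAt (φ : V →ₗ[R] R) (n : ℕ) : Prop :=
  ∀ F : V [⋀^Fin n]→ₗ[R] N, koszulD φ n F = 0 → F ∈ koszulB N φ n

/-- The contraction homotopy, applied to a cocycle, provides the primitive `F.curryLeft v`. -/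
theorem smul_mem_koszulB (φ : V →ₗ[R] R) (v : V) {F : V [⋀^Fin n]→ₗ[R] N}
    (hF : koszulD φ n F = 0) : φ v • F ∈ koszulB N φ n := by
  cases n with
  | zero =>
    rw [mem_koszulB_zero, ← curryLeft_koszulD_zero, hF]
    rfl
  | succ n =>
    refine ⟨F.curryLeft v, ?_⟩
    have := curryLeft_koszulD φ F v
    rw [hF] at this
    exact (sub_eq_zero.mp this.symm).symm

theorem mem_koszulB_compLinearMap {φ : V →ₗ[R] R} (f : W →ₗ[R] V) {F : V [⋀^Fin n]→ₗ[R] N}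
    (hF : F ∈ koszulB N φ n) : F.compLinearMap f ∈ koszulB N (φ ∘ₗ f) n := by
  cases n with
  | zero =>
    rw [mem_koszulB_zero] at hF ⊢
    rw [hF]; rfl
  | succ n =>
    obtain ⟨G, rfl⟩ := hF
    exact ⟨G.compLinearMap f, koszulD_compLinearMap φ f G⟩

/-- The form `(v, c) ↦ φ v + c z` on `V × R`. -/
abbrev formSnoc (φ : V →ₗ[R] R) (z : R) : V × R →ₗ[R] R :=
  φ.coprod (LinearMap.toSpanSingleton R R z)

/-- Restriction of forms along `V → V × R`. -/
abbrev altRes (F : (V × R) [⋀^Fin n]→ₗ[R] N) : V [⋀^Fin n]→ₗ[R] N :=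
  F.compLinearMap (LinearMap.inl R V R)

/-- Contraction with the last basis vector of `V × R`, restricted to `V`. -/
abbrev altContr (F : (V × R) [⋀^Fin (n + 1)]→ₗ[R] N) : V [⋀^Fin n]→ₗ[R] N :=
  altRes (F.curryLeft ((0 : V), (1 : R)))

theorem altRes_koszulD (φ : V →ₗ[R] R) (z : R) (F : (V × R) [⋀^Fin n]→ₗ[R] N) :
    altRes (koszulD (formSnoc φ z) n F) = koszulD φ n (altRes F) := by
  rw [altRes, ← koszulD_compLinearMap, LinearMap.coprod_inl]

theorem altContr_koszulD_zero (φ : V →ₗ[R] R) (z : R) (F : (V × R) [⋀^Fin 0]→ₗ[R] N) :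
    altContr (koszulD (formSnoc φ z) 0 F) = z • altRes F := by
  rw [altContr, curryLeft_koszulD_zero]
  ext w; simp

/-- In the coordinates `(f, g) = (altRes F, altContr F)` the differential is `(f, g) ↦ (D f, z f - D
g)`: the complex on `V × R` is, up to shift, the mapping cone of multiplication by `z`. -/
theorem altContr_koszulD (φ : V →ₗ[R] R) (z : R) (F : (V × R) [⋀^Fin (n + 1)]→ₗ[R] N) :
    altContr (koszulD (formSnoc φ z) (n + 1) F) = z • altRes F - koszulD φ n (altContr F) := by
  have h := altRes_koszulD φ z (F.curryLeft ((0 : V), (1 : R)))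
  rw [altContr, ← h, curryLeft_koszulD]
  ext w; simp

theorem exists_altRes (f : V [⋀^Fin n]→ₗ[R] N) :
    ∃ F : (V × R) [⋀^Fin n]→ₗ[R] N, altRes F = f :=
  ⟨f.compLinearMap (LinearMap.fst R V R), by ext w; simp⟩

theorem exists_altRes_altContr (f : V [⋀^Fin (n + 1)]→ₗ[R] N) (g : V [⋀^Fin n]→ₗ[R] N) :
    ∃ F : (V × R) [⋀^Fin (n + 1)]→ₗ[R] N, altRes F = f ∧ altContr F = g := by
  -- The pullback of `f` plus `dt ∧ g`, where `dt` is the last coordinate, written as the Koszul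
  -- differential of the form `(v, c) ↦ c`.
  refine ⟨f.compLinearMap (LinearMap.fst R V R) +
    koszulD (formSnoc (0 : V →ₗ[R] R) 1) n (g.compLinearMap (LinearMap.fst R V R)), ?_, ?_⟩
  · have h1 : altRes (koszulD (formSnoc (0 : V →ₗ[R] R) 1) n
        (g.compLinearMap (LinearMap.fst R V R))) = 0 := by
      rw [altRes_koszulD, koszulD_zero_form]
    ext w
    have := congrArg (fun F => F w) h1
    simp at this
    simp [this]
  · have h1 : altContr (koszulD (formSnoc (0 : V →ₗ[R] R) 1) n
        (g.compLinearMap (LinearMap.fst R V R))) = g := by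
      cases n with
      | zero => rw [altContr_koszulD_zero]; ext w; simp
      | succ n => rw [altContr_koszulD, koszulD_zero_form]; ext w; simp
    ext w
    have := congrArg (fun F => F w) h1
    simp at this
    simp [this]

theorem altRes_eq_zero_of_zero {F : (V × R) [⋀^Fin 0]→ₗ[R] N} (h : altRes F = 0) : F = 0 := by
  ext w
  have := congrArg (fun F => F (fun _ => 0)) h
  rw [Subsingleton.elim w fun i => LinearMap.inl R V R 0]
  exact this

/-- Split each argument into its `V` part and a multiple of the last basis vector and expand: one
term is a value of `altRes F`, and all others have the last basis vector in some slot. -/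
theorem eq_zero_of_altRes_eq_zero {F : (V × R) [⋀^Fin n]→ₗ[R] N} (h : altRes F = 0)
    (h' : ∀ (w : Fin n → V × R) (i : Fin n), w i = ((0 : V), (1 : R)) → F w = 0) : F = 0 := by
  classical
  ext w
  have hw : w = (fun i => LinearMap.inl R V R (w i).1) +
      (fun i => (w i).2 • ((0 : V), (1 : R))) := by
    funext i; simp
  rw [hw, AlternatingMap.zero_apply, F.map_add_univ]
  refine Finset.sum_eq_zero fun s _ => ?_
  by_cases hs : s = Finset.univ
  · rw [hs, Finset.piecewise_univ]
    exact congrArg (fun G => G fun i => (w i).1) h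
  · obtain ⟨i, hi⟩ : ∃ i, i ∉ s := by
      by_contra! hc
      exact hs (Finset.eq_univ_iff_forall.mpr hc)
    generalize hm : s.piecewise (fun i => LinearMap.inl R V R (w i).1)
      (fun i => (w i).2 • ((0 : V), (1 : R))) = m
    have hmi : m i = (w i).2 • ((0 : V), (1 : R)) := by
      rw [← hm, Finset.piecewise_eq_of_notMem _ _ _ hi]
    rw [← Function.update_eq_self i m, hmi, F.map_update_smul,
      h' _ i (Function.update_self i _ m), smul_zero]

theorem eq_zero_of_altRes_altContr {F : (V × R) [⋀^Fin (n + 1)]→ₗ[R] N}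
    (h : altRes F = 0) (h' : altContr F = 0) : F = 0 := by
  have hG : F.curryLeft ((0 : V), (1 : R)) = 0 :=
    eq_zero_of_altRes_eq_zero h' fun w i hi =>
      F.map_eq_zero_of_eq _ (i := 0) (j := i.succ) (by simp [hi]) (Fin.succ_ne_zero i).symm
  refine eq_zero_of_altRes_eq_zero h fun w i hi => ?_
  have hw := F.map_insertNth i (w i) (i.removeNth w)
  rw [Fin.insertNth_self_removeNth] at hw
  rw [hw, hi]
  have := congrArg (fun G => G (i.removeNth w)) hG
  simp only [curryLeft_apply_apply, AlternatingMap.zero_apply] at this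
  rw [this, smul_zero]

theorem eq_of_altRes_altContr {F G : (V × R) [⋀^Fin (n + 1)]→ₗ[R] N}
    (h : altRes F = altRes G) (h' : altContr F = altContr G) : F = G := by
  refine sub_eq_zero.mp (eq_zero_of_altRes_altContr ?_ ?_)
  · ext w
    simpa [sub_eq_zero] using congrArg (fun F => F w) h
  · ext w
    simpa [sub_eq_zero] using congrArg (fun F => F w) h'

theorem altRes_mem_koszulB {φ : V →ₗ[R] R} {z : R} {F : (V × R) [⋀^Fin n]→ₗ[R] N}
    (hF : F ∈ koszulB N (formSnoc φ z) n) : altRes F ∈ koszulB N φ n := by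
  have := mem_koszulB_compLinearMap (LinearMap.inl R V R) hF
  rwa [LinearMap.coprod_inl] at this

/-- A cocycle on `V × R` whose restriction to `V` is a coboundary is a coboundary, provided the
cohomology on `V` vanishes in the previous degree. -/
theorem mem_koszulB_of_altRes {φ : V →ₗ[R] R} {z : R} {F : (V × R) [⋀^Fin n]→ₗ[R] N}
    (hF : koszulD (formSnoc φ z) n F = 0) (hres : altRes F ∈ koszulB N φ n)
    (hex : ∀ m, m + 1 = n → KoszulExactAt N φ m) : F ∈ koszulB N (formSnoc φ z) n := by
  cases n with
  | zero =>
    rw [mem_koszulB_zero] at hres ⊢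
    exact altRes_eq_zero_of_zero hres
  | succ n =>
    obtain ⟨f', hf'⟩ := hres
    have hc : z • altRes F - koszulD φ n (altContr F) = 0 := by
      rw [← altContr_koszulD, hF]
      rfl
    -- A primitive with coordinates `(f', g')` must satisfy `D g' = z f' - altContr F`, so the right
    -- side has to be a coboundary; exactness one degree lower supplies this.
    have hcyc : koszulD φ n (z • f' - altContr F) = 0 := by
      rw [map_sub, map_smul, hf', hc]
    have hmem := hex n rfl _ hcyc
    cases n with
    | zero =>
      rw [mem_koszulB_zero] at hmem
      obtain ⟨G, hG⟩ := exists_altRes f'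
      refine ⟨G, eq_of_altRes_altContr ?_ ?_⟩
      · rw [altRes_koszulD, hG, hf']
      · rw [altContr_koszulD_zero, hG, sub_eq_zero.mp hmem]
    | succ n =>
      obtain ⟨g', hg'⟩ := hmem
      obtain ⟨G, hG, hG'⟩ := exists_altRes_altContr f' g'
      refine ⟨G, eq_of_altRes_altContr ?_ ?_⟩
      · rw [altRes_koszulD, hG, hf']
      · rw [altContr_koszulD, hG, hG', hg', sub_sub_cancel]

theorem KoszulExactAt.snoc {φ : V →ₗ[R] R} {z : R} (h : KoszulExactAt N φ n)
    (hex : ∀ m, m + 1 = n → KoszulExactAt N φ m) : KoszulExactAt N (formSnoc φ z) n := by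
  intro F hF
  refine mem_koszulB_of_altRes hF (h _ ?_) hex
  rw [← altRes_koszulD, hF]
  rfl

/-- A cocycle on `V` killed by `z` in cohomology lifts to a cocycle on `V × R`. -/
theorem exists_cocycle_altRes {φ : V →ₗ[R] R} {z : R} {f : V [⋀^Fin n]→ₗ[R] N}
    (hf : koszulD φ n f = 0) (hz : z • f ∈ koszulB N φ n) :
    ∃ F : (V × R) [⋀^Fin n]→ₗ[R] N, koszulD (formSnoc φ z) n F = 0 ∧ altRes F = f := by
  cases n with
  | zero =>
    rw [mem_koszulB_zero] at hz
    obtain ⟨F, hF⟩ := exists_altRes f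
    refine ⟨F, eq_zero_of_altRes_altContr ?_ ?_, hF⟩
    · rw [altRes_koszulD, hF, hf]
    · rw [altContr_koszulD_zero, hF, hz]
  | succ n =>
    obtain ⟨g, hg⟩ := hz
    obtain ⟨F, hF, hF'⟩ := exists_altRes_altContr f g
    refine ⟨F, eq_zero_of_altRes_altContr ?_ ?_, hF⟩
    · rw [altRes_koszulD, hF, hf]
    · rw [altContr_koszulD, hF, hF', hg, sub_self]

variable (N) in
/-- The Koszul cohomology of `φ` vanishes below degree `g`, and in degree `g` it has a nonzero
class on which every element of `T` acts nilpotently. -/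
def HasNilpotentClass (φ : V →ₗ[R] R) (g : ℕ) (T : Set R) : Prop :=
  (∀ i < g, KoszulExactAt N φ i) ∧
    ∃ F : V [⋀^Fin g]→ₗ[R] N, koszulD φ g F = 0 ∧ F ∉ koszulB N φ g ∧
      ∀ t ∈ T, ∃ k : ℕ, t ^ k • F ∈ koszulB N φ g

theorem HasNilpotentClass.not_koszulExactAt {φ : V →ₗ[R] R} {g : ℕ} {T : Set R}
    (h : HasNilpotentClass N φ g T) : ¬ KoszulExactAt N φ g := by
  obtain ⟨-, F, hF, hF', -⟩ := h
  exact fun h => hF' (h F hF)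

/-- The last nonzero multiple `z ^ j • F` is killed by `z`, so it lifts to a cocycle on `V × R`.
Restriction to `V` is injective on cohomology in degree `g`, because the cohomology on `V` vanishes
one degree lower; hence nilpotency of `T` transfers to the lift. -/
theorem HasNilpotentClass.snoc {φ : V →ₗ[R] R} {g : ℕ} {T : Set R}
    (h : HasNilpotentClass N φ g T) {z : R} (hz : z ∈ T) :
    HasNilpotentClass N (formSnoc φ z) g T := by
  classical
  obtain ⟨hex, F, hF, hF', hT⟩ := h
  refine ⟨fun i hi => (hex i hi).snoc fun m hm => hex m (by omega), ?_⟩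
  let k := Nat.find (hT z hz)
  have hk : z ^ k • F ∈ koszulB N φ g := Nat.find_spec (hT z hz)
  have hk0 : k ≠ 0 := by
    intro h0
    rw [h0, pow_zero, one_smul] at hk
    exact hF' hk
  obtain ⟨j, hj⟩ := Nat.exists_eq_succ_of_ne_zero hk0
  have hjn : z ^ j • F ∉ koszulB N φ g := Nat.find_min (hT z hz) (by omega)
  have hjz : z • z ^ j • F ∈ koszulB N φ g := by
    rwa [smul_smul, ← pow_succ', ← Nat.succ_eq_add_one, ← hj]
  obtain ⟨G, hG, hGres⟩ := exists_cocycle_altRes (by rw [map_smul, hF, smul_zero]) hjz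
  refine ⟨G, hG, fun hGB => hjn (hGres ▸ altRes_mem_koszulB hGB), fun t ht => ?_⟩
  obtain ⟨l, hl⟩ := hT t ht
  refine ⟨l, mem_koszulB_of_altRes (by rw [map_smul, hG, smul_zero]) ?_
    fun m hm => hex m (by omega)⟩
  have : altRes (t ^ l • G) = z ^ j • t ^ l • F := by
    rw [smul_comm, ← hGres]
    rfl
  rw [this]
  exact Submodule.smul_mem _ _ hl

section Equiv

variable {φ : V →ₗ[R] R} {ψ : W →ₗ[R] R}

theorem koszulD_compLinearMap_equiv (e : W ≃ₗ[R] V) (he : φ ∘ₗ e.toLinearMap = ψ)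
    (F : V [⋀^Fin n]→ₗ[R] N) :
    koszulD ψ n (F.compLinearMap e.toLinearMap) =
      (koszulD φ n F).compLinearMap e.toLinearMap := by
  rw [← he, koszulD_compLinearMap]

theorem compLinearMap_equiv_mem_koszulB (e : W ≃ₗ[R] V) (he : φ ∘ₗ e.toLinearMap = ψ)
    {F : V [⋀^Fin n]→ₗ[R] N} :
    F.compLinearMap e.toLinearMap ∈ koszulB N ψ n ↔ F ∈ koszulB N φ n := by
  refine ⟨fun h => ?_, fun h => he ▸ mem_koszulB_compLinearMap _ h⟩
  have := mem_koszulB_compLinearMap e.symm.toLinearMap h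
  rw [← he, LinearMap.comp_assoc, LinearEquiv.comp_symm, LinearMap.comp_id,
    compLinearMap_assoc, LinearEquiv.comp_symm, compLinearMap_id] at this
  exact this

theorem KoszulExactAt.of_equiv (e : W ≃ₗ[R] V) (he : φ ∘ₗ e.toLinearMap = ψ)
    (h : KoszulExactAt N ψ n) : KoszulExactAt N φ n := by
  intro F hF
  refine (compLinearMap_equiv_mem_koszulB e he).mp (h _ ?_)
  rw [koszulD_compLinearMap_equiv e he, hF]
  rfl

theorem HasNilpotentClass.of_equiv (e : W ≃ₗ[R] V) (he : φ ∘ₗ e.toLinearMap = ψ)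
    {g : ℕ} {T : Set R} (h : HasNilpotentClass N φ g T) : HasNilpotentClass N ψ g T := by
  obtain ⟨hex, F, hF, hF', hT⟩ := h
  have he' : ψ ∘ₗ e.symm.toLinearMap = φ := by
    rw [← he, LinearMap.comp_assoc, LinearEquiv.comp_symm, LinearMap.comp_id]
  refine ⟨fun i hi => (hex i hi).of_equiv e.symm he', F.compLinearMap e.toLinearMap, ?_,
    fun h => hF' ((compLinearMap_equiv_mem_koszulB e he).mp h), fun t ht => ?_⟩
  · rw [koszulD_compLinearMap_equiv e he, hF]
    rfl
  · obtain ⟨k, hk⟩ := hT t ht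
    exact ⟨k, (compLinearMap_equiv_mem_koszulB e he).mpr hk⟩

end Equiv

/-- `V × R^(m+1) ≃ (V × R^m) × R`. -/
def prodFinSuccEquiv (m : ℕ) : (V × (Fin (m + 1) → R)) ≃ₗ[R] (V × (Fin m → R)) × R where
  toFun p := ((p.1, fun j => p.2 j.succ), p.2 0)
  invFun p := (p.1.1, Fin.cons p.2 p.1.2)
  map_add' _ _ := rfl
  map_smul' _ _ := rfl
  left_inv p := by
    refine Prod.ext rfl (funext fun j => ?_)
    refine Fin.cases ?_ (fun j => ?_) j <;> simp
  right_inv p := by simp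

theorem formSnoc_comp_prodFinSuccEquiv (φ : V →ₗ[R] R) {m : ℕ} (y : Fin (m + 1) → R) :
    formSnoc (φ.coprod (Fintype.linearCombination R (Fin.tail y))) (y 0) ∘ₗ
      (prodFinSuccEquiv m).toLinearMap = φ.coprod (Fintype.linearCombination R y) := by
  refine LinearMap.ext fun p => ?_
  simp [prodFinSuccEquiv, Fintype.linearCombination_apply, Fin.sum_univ_succ, Fin.tail]
  abel

theorem coprod_comp_prodUnique (φ : V →ₗ[R] R) (y : Fin 0 → R) :
    φ ∘ₗ (LinearEquiv.prodUnique (R := R) (M := V) (M₂ := Fin 0 → R)).toLinearMap =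
      φ.coprod (Fintype.linearCombination R y) := by
  refine LinearMap.ext fun p => ?_
  simp [Fintype.linearCombination_apply]

theorem HasNilpotentClass.coprod {φ : V →ₗ[R] R} {g : ℕ} {T : Set R}
    (h : HasNilpotentClass N φ g T) {m : ℕ} (y : Fin m → R) (hy : ∀ j, y j ∈ T) :
    HasNilpotentClass N (φ.coprod (Fintype.linearCombination R y)) g T := by
  induction m with
  | zero => exact h.of_equiv _ (coprod_comp_prodUnique φ y)
  | succ m ih =>
    exact ((ih (Fin.tail y) fun j => hy _).snoc (hy 0)).of_equiv _
      (formSnoc_comp_prodFinSuccEquiv φ y)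

theorem KoszulExactAt.coprod {φ : V →ₗ[R] R} {g : ℕ} (h : ∀ i < g, KoszulExactAt N φ i)
    {m : ℕ} (y : Fin m → R) :
    ∀ i < g, KoszulExactAt N (φ.coprod (Fintype.linearCombination R y)) i := by
  induction m with
  | zero =>
    refine fun i hi => (h i hi).of_equiv LinearEquiv.prodUnique.symm ?_
    rw [← coprod_comp_prodUnique φ y, LinearMap.comp_assoc, LinearEquiv.comp_symm,
      LinearMap.comp_id]
  | succ m ih =>
    refine fun i hi => KoszulExactAt.of_equiv (prodFinSuccEquiv m).symm ?_
      ((ih (Fin.tail y) i hi).snoc (z := y 0) fun k hk => ih (Fin.tail y) k (by omega))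
    rw [← formSnoc_comp_prodFinSuccEquiv φ y, LinearMap.comp_assoc, LinearEquiv.comp_symm,
      LinearMap.comp_id]

end KoszulForms

/-! ### Koszul grade of finite sequences -/

section Grade

open AlternatingMap exteriorPower

variable {R : Type u} [CommRing R] {M : Type v} [AddCommGroup M] [Module R M] {r m n : ℕ}

theorem alternatingMapLinearEquiv_koszulD (x : Fin r → R)
    (F : (Fin r → R) [⋀^Fin n]→ₗ[R] M) :
    alternatingMapLinearEquiv (koszulD (koszulForm x) n F) =
      LinearMap.lcomp R M (koszulDifferential x n) (alternatingMapLinearEquiv F) := by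
  apply exteriorPower.linearMap_ext
  ext1 w
  simp [koszulDifferential_ιMulti, koszulD_apply]

theorem alternatingMapLinearEquiv_mem_koszulCocycles (x : Fin r → R)
    (F : (Fin r → R) [⋀^Fin n]→ₗ[R] M) :
    alternatingMapLinearEquiv F ∈ koszulCocycles M x n ↔ koszulD (koszulForm x) n F = 0 := by
  rw [koszulCocycles, LinearMap.mem_ker, ← alternatingMapLinearEquiv_koszulD,
    LinearEquiv.map_eq_zero_iff]

theorem alternatingMapLinearEquiv_mem_koszulCoboundaries (x : Fin r → R)
    (F : (Fin r → R) [⋀^Fin n]→ₗ[R] M) :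
    alternatingMapLinearEquiv F ∈ koszulCoboundaries M x n ↔ F ∈ koszulB M (koszulForm x) n := by
  cases n with
  | zero => simp [koszulCoboundaries, koszulB]
  | succ n =>
    constructor
    · rintro ⟨G, hG⟩
      refine ⟨alternatingMapLinearEquiv.symm G, alternatingMapLinearEquiv.injective ?_⟩
      rw [alternatingMapLinearEquiv_koszulD, LinearEquiv.apply_symm_apply, hG]
    · rintro ⟨G, rfl⟩
      exact ⟨alternatingMapLinearEquiv G, (alternatingMapLinearEquiv_koszulD x G).symm⟩

theorem nontrivial_koszulCohomology_iff (x : Fin r → R) :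
    Nontrivial (KoszulCohomology M x n) ↔ ¬ KoszulExactAt M (koszulForm x) n := by
  rw [Submodule.Quotient.nontrivial_iff, Ne, not_iff_not, Submodule.submoduleOf,
    Submodule.comap_subtype_eq_top]
  constructor
  · intro h F hF
    rw [← alternatingMapLinearEquiv_mem_koszulCoboundaries]
    exact h ((alternatingMapLinearEquiv_mem_koszulCocycles x F).mpr hF)
  · intro h G hG
    obtain ⟨F, rfl⟩ := alternatingMapLinearEquiv.surjective G
    rw [alternatingMapLinearEquiv_mem_koszulCoboundaries]
    exact h F ((alternatingMapLinearEquiv_mem_koszulCocycles x F).mp hG)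

theorem koszulGradeSeq_le (x : Fin r → R) (h : ¬ KoszulExactAt M (koszulForm x) n) :
    koszulGradeSeq M x ≤ n :=
  iInf₂_le n ((nontrivial_koszulCohomology_iff x).mpr h)

theorem koszulExactAt_of_lt_koszulGradeSeq {x : Fin r → R}
    (h : (n : ℕ∞) < koszulGradeSeq M x) : KoszulExactAt M (koszulForm x) n := by
  by_contra hc
  exact absurd (koszulGradeSeq_le x hc) (not_le.mpr h)

theorem le_koszulGradeSeq {x : Fin r → R} {g : ℕ∞}
    (h : ∀ i : ℕ, (i : ℕ∞) < g → KoszulExactAt M (koszulForm x) i) :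
    g ≤ koszulGradeSeq M x := by
  refine le_iInf₂ fun n hn => ?_
  by_contra hc
  exact (nontrivial_koszulCohomology_iff x).mp hn (h n (not_le.mp hc))

theorem not_koszulExactAt_koszulGradeSeq {x : Fin r → R} {g : ℕ}
    (h : koszulGradeSeq M x = g) : ¬ KoszulExactAt M (koszulForm x) g := by
  intro hc
  have : ((g + 1 : ℕ) : ℕ∞) ≤ koszulGradeSeq M x := by
    refine le_koszulGradeSeq fun i hi => ?_
    have hi' : i < g + 1 := by exact_mod_cast hi
    rcases Nat.lt_succ_iff_lt_or_eq.mp hi' with hi'' | rfl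
    · exact koszulExactAt_of_lt_koszulGradeSeq (by rw [h]; exact_mod_cast hi'')
    · exact hc
  rw [h] at this
  exact absurd (Nat.cast_le.mp this) (by omega)

/-- A nilpotent class for `x` bounds the Koszul grade of every sequence acting nilpotently on it. -/
theorem HasNilpotentClass.koszulGradeSeq_le {x : Fin r → R} {g : ℕ} {T : Set R}
    (h : HasNilpotentClass M (koszulForm x) g T) (y : Fin m → R) (hy : ∀ j, y j ∈ T) :
    koszulGradeSeq M y ≤ g := by
  by_contra! hc
  -- The joint sequence of `x` and `y` has a nonzero class in degree `g` when built up from `x`, but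
  -- would be exact through degree `g` when built up from `y`.
  refine (h.coprod y hy).not_koszulExactAt ?_
  have h1 : ∀ i < g + 1, KoszulExactAt M (koszulForm y) i := fun i hi =>
    koszulExactAt_of_lt_koszulGradeSeq
      (lt_of_le_of_lt (Nat.cast_le.mpr (Nat.lt_succ_iff.mp hi)) hc)
  refine KoszulExactAt.of_equiv (LinearEquiv.prodComm R _ _) ?_
    (KoszulExactAt.coprod h1 x g (Nat.lt_succ_self g))
  refine LinearMap.ext fun p => ?_
  simp [koszulForm, add_comm]

/-- The ideal of elements killing the class of `F` in Koszul cohomology. -/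
def koszulColon (x : Fin r → R) (F : (Fin r → R) [⋀^Fin n]→ₗ[R] M) : Ideal R :=
  (koszulB M (koszulForm x) n).comap (LinearMap.toSpanSingleton R _ F)

theorem mem_koszulColon {x : Fin r → R} {F : (Fin r → R) [⋀^Fin n]→ₗ[R] M} {t : R} :
    t ∈ koszulColon x F ↔ t • F ∈ koszulB M (koszulForm x) n := by
  simp [koszulColon]

theorem span_le_koszulColon {x : Fin r → R} {F : (Fin r → R) [⋀^Fin n]→ₗ[R] M}
    (hF : koszulD (koszulForm x) n F = 0) : Ideal.span (Set.range x) ≤ koszulColon x F := by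
  rw [Ideal.span_le]
  rintro _ ⟨j, rfl⟩
  refine mem_koszulColon.mpr ?_
  have := smul_mem_koszulB (koszulForm x) (Pi.single j 1) hF
  simpa [koszulForm, Fintype.linearCombination_apply, Pi.single_apply] using this

theorem annihilator_le_koszulColon {x : Fin r → R} {F : (Fin r → R) [⋀^Fin n]→ₗ[R] M} :
    Module.annihilator R M ≤ koszulColon x F := by
  intro t ht
  rw [mem_koszulColon]
  have : t • F = 0 := by
    ext w
    simpa using Module.mem_annihilator.mp ht (F w)
  rw [this]
  exact zero_mem _

theorem exists_hasNilpotentClass {x : Fin r → R} {g : ℕ} (h : koszulGradeSeq M x = g) :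
    ∃ F : (Fin r → R) [⋀^Fin g]→ₗ[R] M, koszulD (koszulForm x) g F = 0 ∧
      F ∉ koszulB M (koszulForm x) g ∧
      HasNilpotentClass M (koszulForm x) g (koszulColon x F).radical := by
  have := not_koszulExactAt_koszulGradeSeq h
  simp only [KoszulExactAt, not_forall] at this
  obtain ⟨F, hF, hF'⟩ := this
  refine ⟨F, hF, hF', fun i hi => koszulExactAt_of_lt_koszulGradeSeq
    (by rw [h]; exact_mod_cast hi), F, hF, hF', ?_⟩
  rintro t ⟨k, hk⟩
  exact ⟨k, mem_koszulColon.mp hk⟩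

/-- Both `x` and the annihilator of `M` kill Koszul cohomology, so the radical of their sum acts
nilpotently on any class. -/
theorem koszulGradeSeq_le_of_mem_radical (x : Fin r → R) (y : Fin m → R)
    (hy : ∀ j, y j ∈ (Ideal.span (Set.range x) ⊔ Module.annihilator R M).radical) :
    koszulGradeSeq M y ≤ koszulGradeSeq M x := by
  cases hg : koszulGradeSeq M x with
  | top => exact le_top
  | coe g =>
    obtain ⟨F, hF, -, h⟩ := exists_hasNilpotentClass hg
    exact h.koszulGradeSeq_le y fun j => Ideal.radical_mono
      (sup_le (span_le_koszulColon hF) annihilator_le_koszulColon) (hy j)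

/-- The Koszul grade of a product of two ideals is at least the minimum of their grades. -/
theorem min_koszulGradeSeq_le {s : ℕ} (y : Fin s → R) (b : Fin r → R) (c : Fin m → R)
    (hy : ∀ i j, b i * c j ∈ Ideal.span (Set.range y)) :
    min (koszulGradeSeq M b) (koszulGradeSeq M c) ≤ koszulGradeSeq M y := by
  cases hg : koszulGradeSeq M y with
  | top => exact le_top
  | coe g =>
    obtain ⟨F, hF, hF', h⟩ := exists_hasNilpotentClass hg
    -- Either every `b i` kills the class of `F`, or some `b i • F` is a nonzero class, killed by
    -- every `c j` because `b i * c j` lies in the ideal of `y`.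
    by_cases hb : ∀ i, b i ∈ koszulColon y F
    · exact (min_le_left _ _).trans
        (h.koszulGradeSeq_le b fun i => Ideal.le_radical (hb i))
    · push Not at hb
      obtain ⟨i, hi⟩ := hb
      have h' : HasNilpotentClass M (koszulForm y) g (Set.range c) := by
        refine ⟨h.1, b i • F, by rw [map_smul, hF, smul_zero],
          fun hc => hi (mem_koszulColon.mpr hc), ?_⟩
        rintro _ ⟨j, rfl⟩
        refine ⟨1, ?_⟩
        rw [pow_one, smul_smul, mul_comm, ← mem_koszulColon]
        exact span_le_koszulColon hF (hy i j)
      exact (min_le_right _ _).trans (h'.koszulGradeSeq_le c fun j => ⟨j, rfl⟩)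

theorem koszulGradeSeq_eq_top_of_span_eq_top {x : Fin r → R}
    (hx : Ideal.span (Set.range x) = ⊤) : koszulGradeSeq M x = ⊤ := by
  refine top_le_iff.mp (le_koszulGradeSeq fun i _ F hF => ?_)
  have : (1 : R) ∈ koszulColon x F := span_le_koszulColon hF (hx ▸ Submodule.mem_top)
  simpa [mem_koszulColon] using this

/-- Top Koszul cohomology is `M / (x)M`, through evaluation at the standard basis; the determinant
times `a ∉ (x)M` represents a nonzero class. -/
theorem not_koszulExactAt_top_degree (x : Fin r → R)
    (hx : Ideal.span (Set.range x) • (⊤ : Submodule R M) ≠ ⊤) :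
    ¬ KoszulExactAt M (koszulForm x) r := by
  intro hex
  obtain ⟨a, -, ha⟩ := SetLike.exists_of_lt (lt_top_iff_ne_top.mpr hx)
  let e := Pi.basisFun R (Fin r)
  let F : (Fin r → R) [⋀^Fin r]→ₗ[R] M :=
    (LinearMap.toSpanSingleton R M a).compAlternatingMap e.det
  have hF : koszulD (koszulForm x) r F = 0 := by
    refine Module.Basis.ext_alternating e fun v hv => ?_
    exact absurd (Fintype.card_le_of_injective v hv) (by simp)
  have hFe : F e = a := by simp [F, e.det_self]
  have hB : ∀ G ∈ koszulB M (koszulForm x) r,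
      G e ∈ Ideal.span (Set.range x) • (⊤ : Submodule R M) := by
    intro G hG
    cases r with
    | zero =>
      rw [mem_koszulB_zero] at hG
      rw [hG]
      exact zero_mem _
    | succ r =>
      obtain ⟨H, rfl⟩ := hG
      rw [koszulD_apply]
      refine sum_mem fun j _ => zsmul_mem (Submodule.smul_mem_smul ?_ Submodule.mem_top) _
      have : koszulForm x (e j) = x j := by
        simp [e, koszulForm, Fintype.linearCombination_apply, Pi.single_apply]
      rw [this]
      exact Ideal.subset_span ⟨j, rfl⟩
  exact ha (hFe ▸ hB F (hex F hF))

end Grade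

/-- Otherwise `I` misses the monoid generated by `t` and the complement of `p`, and a prime over `I`
disjoint from it would lie in `p` without containing `t`, against minimality. -/
theorem Ideal.exists_mul_pow_mem_of_mem_minimalPrimes {R : Type*} [CommRing R] {I p : Ideal R}
    (hp : p ∈ I.minimalPrimes) {t : R} (ht : t ∈ p) :
    ∃ s ∉ p, ∃ k : ℕ, s * t ^ k ∈ I := by
  have := hp.1.1
  by_contra! hc
  obtain ⟨q, hq, hIq, hdisj⟩ := Ideal.exists_le_prime_disjoint I
    (p.primeCompl ⊔ Submonoid.powers t) (by
      rw [Set.disjoint_left]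
      intro z hz hz'
      obtain ⟨s, hs, y, ⟨k, rfl⟩, rfl⟩ := Submonoid.mem_sup.mp hz'
      exact hc s hs k hz)
  rw [Set.disjoint_left] at hdisj
  have hqp : q ≤ p := fun z hz => by
    by_contra hzp
    exact hdisj hz (Submonoid.mem_sup_left (show z ∈ p.primeCompl from hzp))
  exact hdisj (hp.2 ⟨hq, hIq⟩ hqp ht) (Submonoid.mem_sup_right (Submonoid.mem_powers t))

/-! ### Independence of Koszul cohomology from the base ring -/

section BaseChange

open AlternatingMap exteriorPower

variable {R S : Type*} [CommRing R] [CommRing S] [Algebra R S] {N : Type*} [AddCommGroup N]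
  [Module R N] [Module S N] [IsScalarTower R S N] {r n : ℕ}

variable (R) in
/-- Restriction of an `S`-alternating map on `S^r` to an `R`-alternating map on `R^r`. -/
def altRestrict (F : (Fin r → S) [⋀^Fin n]→ₗ[S] N) : (Fin r → R) [⋀^Fin n]→ₗ[R] N where
  toMultilinearMap := (F.toMultilinearMap.restrictScalars R).compLinearMap
    fun _ => (Algebra.linearMap R S).compLeft (Fin r)
  map_eq_zero_of_eq' w i j hw hij := F.map_eq_zero_of_eq _ (by simp [hw]) hij

theorem altRestrict_apply (F : (Fin r → S) [⋀^Fin n]→ₗ[S] N) (w : Fin n → Fin r → R) :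
    altRestrict R F w = F fun i => (Algebra.linearMap R S).compLeft (Fin r) (w i) := rfl

theorem altRestrict_smul (t : R) (F : (Fin r → S) [⋀^Fin n]→ₗ[S] N) :
    altRestrict R (algebraMap R S t • F) = t • altRestrict R F := by
  ext w
  simp [altRestrict_apply]

theorem compLeft_basisFun (j : Fin r) :
    (Algebra.linearMap R S).compLeft (Fin r) (Pi.basisFun R (Fin r) j) =
      Pi.basisFun S (Fin r) j := by
  ext k
  by_cases h : k = j <;> simp [h]

theorem altRestrict_injective : Function.Injective
    (altRestrict R : ((Fin r → S) [⋀^Fin n]→ₗ[S] N) → ((Fin r → R) [⋀^Fin n]→ₗ[R] N)) := by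
  intro F G h
  refine Module.Basis.ext_alternating (Pi.basisFun S (Fin r)) fun v _ => ?_
  have := congrArg (fun F => F fun i => Pi.basisFun R (Fin r) (v i)) h
  simpa only [altRestrict_apply, compLeft_basisFun] using this

/-- Over either ring an alternating map is freely determined by its values on increasing wedges of
standard basis vectors. -/
theorem altRestrict_surjective : Function.Surjective
    (altRestrict R : ((Fin r → S) [⋀^Fin n]→ₗ[S] N) → ((Fin r → R) [⋀^Fin n]→ₗ[R] N)) := by
  intro G
  let bS := (Pi.basisFun S (Fin r)).exteriorPower n
  let bR := (Pi.basisFun R (Fin r)).exteriorPower n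
  let L : ⋀[S]^n (Fin r → S) →ₗ[S] N :=
    bS.constr S fun s => alternatingMapLinearEquiv G (bR s)
  refine ⟨alternatingMapLinearEquiv.symm L, alternatingMapLinearEquiv.injective ?_⟩
  refine bR.ext fun s => ?_
  have hL : L (bS s) = alternatingMapLinearEquiv G (bR s) := bS.constr_basis S _ s
  rw [← hL]
  simp only [bR, bS, exteriorPower.basis_apply, exteriorPower.ιMulti_family,
    alternatingMapLinearEquiv_apply_ιMulti, altRestrict_apply,
    alternatingMapLinearEquiv_symm_apply, Function.comp_apply, compLeft_basisFun]
  rfl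

theorem koszulForm_algebraMap (x : Fin r → R) (w : Fin r → R) :
    koszulForm (fun j => algebraMap R S (x j)) ((Algebra.linearMap R S).compLeft (Fin r) w) =
      algebraMap R S (koszulForm x w) := by
  simp [koszulForm, Fintype.linearCombination_apply]

theorem altRestrict_koszulD (x : Fin r → R) (F : (Fin r → S) [⋀^Fin n]→ₗ[S] N) :
    altRestrict R (koszulD (koszulForm fun j => algebraMap R S (x j)) n F) =
      koszulD (koszulForm x) n (altRestrict R F) := by
  ext w
  simp only [altRestrict_apply, koszulD_apply, koszulForm_algebraMap, algebraMap_smul]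
  rfl

theorem altRestrict_mem_koszulB {x : Fin r → R} {F : (Fin r → S) [⋀^Fin n]→ₗ[S] N} :
    altRestrict R F ∈ koszulB N (koszulForm x) n ↔
      F ∈ koszulB N (koszulForm fun j => algebraMap R S (x j)) n := by
  cases n with
  | zero =>
    rw [mem_koszulB_zero, mem_koszulB_zero]
    exact altRestrict_injective.eq_iff' rfl
  | succ n =>
    simp only [mem_koszulB_succ]
    constructor
    · rintro ⟨G, hG⟩
      obtain ⟨G, rfl⟩ := altRestrict_surjective (S := S) G
      exact ⟨G, altRestrict_injective (by rw [altRestrict_koszulD, hG])⟩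
    · rintro ⟨G, rfl⟩
      exact ⟨altRestrict R G, (altRestrict_koszulD x G).symm⟩

theorem altRestrict_koszulD_eq_zero {x : Fin r → R} {F : (Fin r → S) [⋀^Fin n]→ₗ[S] N} :
    koszulD (koszulForm x) n (altRestrict R F) = 0 ↔
      koszulD (koszulForm fun j => algebraMap R S (x j)) n F = 0 := by
  rw [← altRestrict_koszulD]
  exact altRestrict_injective.eq_iff' rfl

theorem KoszulExactAt.algebraMap {x : Fin r → R} (h : KoszulExactAt N (koszulForm x) n) :
    KoszulExactAt N (koszulForm fun j => algebraMap R S (x j)) n := fun _ hF =>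
  altRestrict_mem_koszulB.mp (h _ (altRestrict_koszulD_eq_zero.mpr hF))

end BaseChange

/-! ### Koszul cohomology and localization of the module -/

section Localization

open AlternatingMap exteriorPower

variable {R : Type*} [CommRing R] {M N : Type*} [AddCommGroup M] [Module R M] [AddCommGroup N]
  [Module R N] {r n : ℕ}

theorem koszulD_compAlternatingMap (f : M →ₗ[R] N) (x : Fin r → R) (F : (Fin r → R) [⋀^Fin n]→ₗ[R] M) :
    koszulD (koszulForm x) n (f.compAlternatingMap F) =
      f.compAlternatingMap (koszulD (koszulForm x) n F) := by
  ext w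
  simp [koszulD_apply]

theorem compAlternatingMap_mem_koszulB (f : M →ₗ[R] N) {x : Fin r → R} {F : (Fin r → R) [⋀^Fin n]→ₗ[R] M}
    (h : F ∈ koszulB M (koszulForm x) n) :
    f.compAlternatingMap F ∈ koszulB N (koszulForm x) n := by
  cases n with
  | zero =>
    rw [mem_koszulB_zero] at h ⊢
    rw [h]
    ext w
    simp
  | succ n =>
    obtain ⟨G, rfl⟩ := h
    exact ⟨f.compAlternatingMap G, koszulD_compAlternatingMap f x G⟩

/-- `⋀^n R^r` is finite free, hence finitely presented, so a common denominator can be cleared. -/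
theorem exists_compAlternatingMap_eq_smul (f : M →ₗ[R] N) (T : Submonoid R)
    [IsLocalizedModule T f] (G : (Fin r → R) [⋀^Fin n]→ₗ[R] N) :
    ∃ (F : (Fin r → R) [⋀^Fin n]→ₗ[R] M) (s : T), f.compAlternatingMap F = (s : R) • G := by
  have : Module.FinitePresentation R (⋀[R]^n (Fin r → R)) :=
    Module.finitePresentation_of_projective R _
  obtain ⟨h, s, hs⟩ := Module.FinitePresentation.exists_lift_of_isLocalizedModule T f
    (alternatingMapLinearEquiv G)
  refine ⟨alternatingMapLinearEquiv.symm h, s, ?_⟩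
  ext w
  simpa [Submonoid.smul_def] using congrArg (fun g => g (ιMulti R n w)) hs

theorem exists_smul_eq_zero_of_compAlternatingMap (f : M →ₗ[R] N) (T : Submonoid R)
    [IsLocalizedModule T f] (F : (Fin r → R) [⋀^Fin n]→ₗ[R] M)
    (h : f.compAlternatingMap F = 0) : ∃ s : T, (s : R) • F = 0 := by
  obtain ⟨s, hs⟩ := Module.Finite.exists_smul_of_comp_eq_of_isLocalizedModule T f
    (alternatingMapLinearEquiv F) 0 (by
      apply exteriorPower.linearMap_ext
      ext1 w
      simpa using congrArg (fun g => g w) h)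
  refine ⟨s, alternatingMapLinearEquiv.injective ?_⟩
  rw [map_smul, _root_.map_zero]
  simpa [Submonoid.smul_def] using hs

theorem mem_koszulB_of_smul_mem (f : M →ₗ[R] N) (T : Submonoid R) [IsLocalizedModule T f]
    {x : Fin r → R} {G : (Fin r → R) [⋀^Fin n]→ₗ[R] N} (s : T)
    (h : (s : R) • G ∈ koszulB N (koszulForm x) n) : G ∈ koszulB N (koszulForm x) n := by
  obtain ⟨u, hu⟩ := IsLocalizedModule.map_units f s
  have hinj (a : N) : u.inv ((s : R) • a) = a := by
    have := congrArg (fun g => g a) u.inv_val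
    rw [hu] at this
    simpa using this
  have hG {k : ℕ} (G : (Fin r → R) [⋀^Fin k]→ₗ[R] N) :
      LinearMap.compAlternatingMap u.inv ((s : R) • G) = G := by
    ext w
    exact hinj _
  rw [← hG G]
  exact compAlternatingMap_mem_koszulB u.inv h

theorem KoszulExactAt.of_isLocalizedModule (f : M →ₗ[R] N) (T : Submonoid R)
    [IsLocalizedModule T f] {x : Fin r → R} (h : KoszulExactAt M (koszulForm x) n) : KoszulExactAt N (koszulForm x) n := by
  intro G hG
  obtain ⟨F, s, hF⟩ := exists_compAlternatingMap_eq_smul f T G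
  obtain ⟨s', hs'⟩ := exists_smul_eq_zero_of_compAlternatingMap f T
    (koszulD (koszulForm x) n F) (by
      rw [← koszulD_compAlternatingMap, hF, map_smul, hG, smul_zero])
  have := compAlternatingMap_mem_koszulB f (h ((s' : R) • F) (by rw [map_smul, hs']))
  refine mem_koszulB_of_smul_mem f T s (mem_koszulB_of_smul_mem f T s' ?_)
  rw [← hF]
  convert this using 1
  ext w
  simp

theorem exists_smul_mem_koszulB (f : M →ₗ[R] N) (T : Submonoid R)
    [IsLocalizedModule T f] {x : Fin r → R} {F : (Fin r → R) [⋀^Fin n]→ₗ[R] M}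
    (h : f.compAlternatingMap F ∈ koszulB N (koszulForm x) n) :
    ∃ s : T, (s : R) • F ∈ koszulB M (koszulForm x) n := by
  cases n with
  | zero =>
    obtain ⟨s, hs⟩ := exists_smul_eq_zero_of_compAlternatingMap f T F (mem_koszulB_zero.mp h)
    exact ⟨s, mem_koszulB_zero.mpr hs⟩
  | succ n =>
    obtain ⟨H, hH⟩ := h
    obtain ⟨H', s, hs⟩ := exists_compAlternatingMap_eq_smul f T H
    obtain ⟨s', hs'⟩ := exists_smul_eq_zero_of_compAlternatingMap f T
      ((s : R) • F - koszulD (koszulForm x) n H') (by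
        have h1 := koszulD_compAlternatingMap f x H'
        rw [hs, map_smul, hH] at h1
        ext w
        have := congrArg (fun g => g w) h1
        simp at this
        simp [this])
    refine ⟨s' * s, (s' : R) • H', ?_⟩
    rw [map_smul, Submonoid.coe_mul, mul_smul]
    rw [smul_sub, sub_eq_zero] at hs'
    exact hs'.symm

end Localization

/-! ### Grade at a localization -/

section LocalGrade

variable {R : Type u} [CommRing R] {M : Type v} [AddCommGroup M] [Module R M] {r : ℕ}

theorem koszulGradeSeq_le_localization (p : Ideal R) [p.IsPrime] (x : Fin r → R) :
    koszulGradeSeq M x ≤ koszulGradeSeq (LocalizedModule p.primeCompl M)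
      fun j => algebraMap R (Localization.AtPrime p) (x j) :=
  le_koszulGradeSeq fun _ hi =>
    ((koszulExactAt_of_lt_koszulGradeSeq hi).of_isLocalizedModule
      (LocalizedModule.mkLinearMap p.primeCompl M) p.primeCompl).algebraMap

/-- A nonzero class in the first nonvanishing Koszul cohomology localizes, at a minimal prime of
its annihilator, to a class on which the maximal ideal acts nilpotently. -/
theorem hasNilpotentClass_localization {x : Fin r → R} {g : ℕ}
    (hex : ∀ i < g, KoszulExactAt M (koszulForm x) i)
    {F : (Fin r → R) [⋀^Fin g]→ₗ[R] M} (hF : koszulD (koszulForm x) g F = 0)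
    {p : Ideal R} [p.IsPrime] (hp : p ∈ (koszulColon x F).minimalPrimes) :
    HasNilpotentClass (LocalizedModule p.primeCompl M)
      (koszulForm fun j => algebraMap R (Localization.AtPrime p) (x j)) g
      (p.map (algebraMap R (Localization.AtPrime p)) : Set (Localization.AtPrime p)) := by
  let f := LocalizedModule.mkLinearMap p.primeCompl M
  let S := Localization.AtPrime p
  refine ⟨fun i hi => ((hex i hi).of_isLocalizedModule f p.primeCompl).algebraMap, ?_⟩
  obtain ⟨G, hG⟩ := altRestrict_surjective (S := S) (f.compAlternatingMap F)
  refine ⟨G, ?_, ?_, ?_⟩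
  · rw [← altRestrict_koszulD_eq_zero, hG, koszulD_compAlternatingMap, hF]
    ext w
    simp
  · rw [← altRestrict_mem_koszulB, hG]
    intro h
    obtain ⟨s, hs⟩ := exists_smul_mem_koszulB f p.primeCompl h
    exact s.2 (hp.1.2 (mem_koszulColon.mpr hs))
  · intro z hz
    obtain ⟨⟨⟨t, ht⟩, s⟩, hts⟩ := (IsLocalization.mem_map_algebraMap_iff p.primeCompl S).mp hz
    obtain ⟨s', hs', k, hk⟩ : ∃ s' ∉ p, ∃ k : ℕ, s' * t ^ k ∈ koszulColon x F :=
      Ideal.exists_mul_pow_mem_of_mem_minimalPrimes hp ht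
    refine ⟨k, ?_⟩
    -- `s' * t ^ k` kills the class of `F`, and `s' ∉ p` acts invertibly after localization.
    have h1 : t ^ k • f.compAlternatingMap F ∈ koszulB _ (koszulForm x) g := by
      refine mem_koszulB_of_smul_mem f p.primeCompl ⟨s', hs'⟩ ?_
      have := compAlternatingMap_mem_koszulB f (mem_koszulColon.mp hk)
      convert this using 1
      ext w
      simp [mul_smul]
    rw [← hG, ← altRestrict_smul, altRestrict_mem_koszulB, map_pow] at h1
    dsimp only at hts
    rw [← hts, mul_pow, mul_comm, mul_smul] at h1
    exact (Submodule.smul_mem_iff_of_isUnit _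
      ((IsLocalization.map_units S s).pow k)).mp h1

end LocalGrade

/-! ### Kronecker's theorem without Noetherian hypotheses -/

section Kronecker

variable {R : Type*} [CommRing R] {n r : ℕ}

/-- Every chain of primes containing `I` has length at most `n`. -/
def Ideal.ChainsLE (I : Ideal R) (n : ℕ) : Prop :=
  ∀ c : LTSeries (PrimeSpectrum R), I ≤ c.head.asIdeal → c.length ≤ n

/-- The ideal defining the boundary of the open set `D(b)` in `V(I)`. -/
def Ideal.boundary (I : Ideal R) (b : R) : Ideal R :=
  I ⊔ Ideal.span {b} ⊔ Submodule.comap (LinearMap.toSpanSingleton R R b) I.radical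

/-- A prime containing the boundary ideal is never minimal over `I`, so each chain extends downwards
by one step: if a minimal prime contains `b`, some `s` outside it has `s * b` nilpotent modulo `I`,
and that `s` lies in the boundary ideal. -/
theorem Ideal.ChainsLE.boundary {I : Ideal R} (h : I.ChainsLE (n + 1)) (b : R) :
    (I.boundary b).ChainsLE n := by
  intro c hc
  have hI : I ≤ c.head.asIdeal := (le_sup_left.trans le_sup_left).trans hc
  have hb : b ∈ c.head.asIdeal :=
    hc (Ideal.mem_sup_left (Ideal.mem_sup_right (Ideal.mem_span_singleton_self b)))
  obtain ⟨q, hq, hqc⟩ := Ideal.exists_minimalPrimes_le hI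
  have hne : q ≠ c.head.asIdeal := by
    rintro rfl
    obtain ⟨s, hs, k, hk⟩ := Ideal.exists_mul_pow_mem_of_mem_minimalPrimes hq hb
    refine hs (hc (Ideal.mem_sup_right ?_))
    rw [Submodule.mem_comap, LinearMap.toSpanSingleton_apply, smul_eq_mul]
    refine ⟨k + 1, ?_⟩
    have : (s * b) ^ (k + 1) = s ^ k * b * (s * b ^ k) := by ring
    rw [this]
    exact I.mul_mem_left _ hk
  have hlt : (⟨q, hq.1.1⟩ : PrimeSpectrum R) < c.head :=
    lt_of_le_of_ne hqc fun h => hne (congrArg PrimeSpectrum.asIdeal h)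
  have := h (c.cons ⟨q, hq.1.1⟩ hlt) (by simpa using hq.1.2)
  simpa using this

/-- Local form of Kronecker's theorem: over a local ring, if `V(I)` has dimension at most `n`, then
modulo `I` any `n + 1` elements `a, b_1, …, b_n` of the maximal ideal generate an ideal with the
same radical as `n` elements `b_j + a c_j`. -/
theorem Ideal.ChainsLE.exists_mem_radical [IsLocalRing R] {I : Ideal R} (h : I.ChainsLE n)
    {a : R} (ha : a ∈ IsLocalRing.maximalIdeal R) (b : Fin n → R) :
    ∃ c : Fin n → R, a ∈ (I ⊔ Ideal.span (Set.range fun j => b j + a * c j)).radical := by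
  induction n generalizing I with
  | zero =>
    -- In dimension zero the maximal ideal is the only prime that can contain `I`, so `a` already
    -- lies in the radical of `I`.
    refine ⟨0, Ideal.radical_mono le_sup_left ?_⟩
    rw [Ideal.radical_eq_sInf, Ideal.mem_sInf]
    rintro q ⟨hIq, hq⟩
    by_cases hqm : q = IsLocalRing.maximalIdeal R
    · rwa [hqm]
    · have hlt : (⟨q, hq⟩ : PrimeSpectrum R) < IsLocalRing.closedPoint R :=
        lt_of_le_of_ne (IsLocalRing.le_maximalIdeal hq.ne_top)
          fun h => hqm (congrArg PrimeSpectrum.asIdeal h)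
      let c : LTSeries (PrimeSpectrum R) :=
        { length := 1
          toFun := ![⟨q, hq⟩, IsLocalRing.closedPoint R]
          step := fun i => by
            rw [Subsingleton.elim i 0]
            exact hlt }
      exact absurd (h c hIq) (by simp [c])
  | succ n ih =>
    -- This gives `a ^ k = i + y * b 0 + w + v` with `w * b 0` in the radical of `I`; the component
    -- `w` becomes the new coefficient of `a`.
    obtain ⟨c, k, hk⟩ := ih (h.boundary (b 0)) (Fin.tail b)
    obtain ⟨u, hu, v, hv, huv⟩ := Submodule.mem_sup.mp hk
    obtain ⟨u', hu', w, hw, rfl⟩ := Submodule.mem_sup.mp hu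
    obtain ⟨i, hi, z, hz, rfl⟩ := Submodule.mem_sup.mp hu'
    obtain ⟨y, rfl⟩ := Ideal.mem_span_singleton'.mp hz
    rw [Submodule.mem_comap, LinearMap.toSpanSingleton_apply, smul_eq_mul] at hw
    refine ⟨Fin.cons w c, ?_⟩
    set K := I ⊔ Ideal.span
      (Set.range fun j => b j + a * (Fin.cons w c : Fin (n + 1) → R) j) with hK
    have hIK : I ≤ K := le_sup_left
    have hgen : ∀ j, b j + a * (Fin.cons w c : Fin (n + 1) → R) j ∈ K := fun j =>
      Ideal.mem_sup_right (Ideal.subset_span ⟨j, rfl⟩)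
    have hvK : v ∈ K := by
      refine (Ideal.span_le.mpr ?_ : Ideal.span _ ≤ K) hv
      rintro _ ⟨j, rfl⟩
      simpa [Fin.tail] using hgen j.succ
    have h0 : b 0 + a * w ∈ K.radical := by simpa using Ideal.le_radical (hgen 0)
    have hwb : w * b 0 ∈ K.radical := Ideal.radical_mono hIK hw
    -- `b 0` and `a * w` have sum and product in the radical of `K`, so each of them lies there.
    have hb0 : b 0 ∈ K.radical := by
      refine (Ideal.radical_isRadical K) ⟨2, ?_⟩
      have : b 0 ^ 2 = b 0 * (b 0 + a * w) - a * (w * b 0) := by ring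
      rw [this]
      exact sub_mem (Ideal.mul_mem_left _ _ h0) (Ideal.mul_mem_left _ _ hwb)
    have haw : a * w ∈ K.radical := by simpa using sub_mem h0 hb0
    refine (Ideal.radical_isRadical K) ⟨k + 1, ?_⟩
    have : a ^ (k + 1) = a * i + a * y * b 0 + a * w + a * v := by
      rw [pow_succ', ← huv]; ring
    rw [this]
    exact add_mem (add_mem (add_mem (Ideal.mul_mem_left _ _ (Ideal.le_radical (hIK hi)))
      (Ideal.mul_mem_left _ _ hb0)) haw) (Ideal.mul_mem_left _ _ (Ideal.le_radical hvK))

/-- Generators are absorbed one at a time: once `x 0` is in the radical, so is each `b j = (b j + x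
0 * c j) - x 0 * c j`, and the count stays at `n`. -/
theorem Ideal.ChainsLE.exists_generators [IsLocalRing R] {I : Ideal R} (h : I.ChainsLE n)
    (x : Fin r → R) (hx : ∀ j, x j ∈ IsLocalRing.maximalIdeal R) :
    ∃ y : Fin n → R, (∀ j, y j ∈ IsLocalRing.maximalIdeal R) ∧
      ∀ j, x j ∈ (I ⊔ Ideal.span (Set.range y)).radical := by
  induction r with
  | zero => exact ⟨0, fun _ => zero_mem _, fun j => j.elim0⟩
  | succ r ih =>
    obtain ⟨b, hb, hxb⟩ := ih (Fin.tail x) fun j => hx _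
    obtain ⟨c, hc⟩ := h.exists_mem_radical (hx 0) b
    set K := I ⊔ Ideal.span (Set.range fun j => b j + x 0 * c j) with hK
    have hbK : I ⊔ Ideal.span (Set.range b) ≤ K.radical := by
      refine sup_le (le_sup_left.trans Ideal.le_radical) (Ideal.span_le.mpr ?_)
      rintro _ ⟨j, rfl⟩
      have h1 : b j + x 0 * c j ∈ K.radical :=
        Ideal.le_radical (Ideal.mem_sup_right (Ideal.subset_span ⟨j, rfl⟩))
      simpa using sub_mem h1 (Ideal.mul_mem_right (c j) _ hc)
    refine ⟨fun j => b j + x 0 * c j,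
      fun j => add_mem (hb j) (Ideal.mul_mem_right _ _ (hx 0)), fun j => ?_⟩
    refine Fin.cases hc (fun j => ?_) j
    exact (Ideal.radical_isRadical K).radical_le_iff.mpr hbK (hxb j)

end Kronecker

/-! ### Grade is at most height; primes of small grade -/

section Height

variable {R : Type u} [CommRing R] {M : Type v} [AddCommGroup M] [Module R M] {r : ℕ}

/-- Kronecker replaces `x` by `d` elements of the maximal ideal of no smaller grade; Nakayama makes
their cohomology in degree `d` nonzero. -/
theorem koszulGradeSeq_le_of_chainsLE [IsLocalRing R] [Module.Finite R M] [Nontrivial M] {d : ℕ}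
    (hd : (Module.annihilator R M).ChainsLE d) (x : Fin r → R)
    (hx : ∀ j, x j ∈ IsLocalRing.maximalIdeal R) : koszulGradeSeq M x ≤ d := by
  obtain ⟨y, hy, hxy⟩ := hd.exists_generators x hx
  refine (koszulGradeSeq_le_of_mem_radical y x fun j => sup_comm (Module.annihilator R M) _ ▸
    hxy j).trans (koszulGradeSeq_le y (not_koszulExactAt_top_degree y ?_))
  refine (Submodule.top_ne_ideal_smul_of_le_jacobson_annihilator ?_).symm
  refine le_trans (Ideal.span_le.mpr ?_) (IsLocalRing.maximalIdeal_le_jacobson _)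
  rintro _ ⟨j, rfl⟩
  exact hy j

/-- The contraction of a prime in the support of `M_p` is in the support of `M`. -/
theorem comap_mem_support_of_mem_support (p : Ideal R) [p.IsPrime] [Module.Finite R M]
    {Q : PrimeSpectrum (Localization.AtPrime p)}
    (hQ : Module.annihilator (Localization.AtPrime p) (LocalizedModule p.primeCompl M) ≤
      Q.asIdeal) :
    Q.comap (algebraMap R (Localization.AtPrime p)) ∈ Module.support R M := by
  rw [Module.mem_support_iff_of_finite]
  intro t ht
  refine hQ (Module.mem_annihilator.mpr fun m => ?_)
  obtain ⟨⟨m, s⟩, rfl⟩ := IsLocalizedModule.mk'_surjective p.primeCompl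
    (LocalizedModule.mkLinearMap p.primeCompl M) m
  rw [algebraMap_smul, Function.uncurry_apply_pair, ← IsLocalizedModule.mk'_smul,
    Module.mem_annihilator.mp ht, IsLocalizedModule.mk'_zero]

theorem comap_localization_strictMono (p : Ideal R) [p.IsPrime] :
    StrictMono (PrimeSpectrum.comap (algebraMap R (Localization.AtPrime p))) := fun _ _ h =>
  lt_of_le_of_ne (Ideal.comap_mono h.le) fun he =>
    h.ne (PrimeSpectrum.localization_comap_injective _ p.primeCompl he)

theorem map_mem_support_localization {p q : PrimeSpectrum R} (hq : q ∈ Module.support R M)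
    (hqp : q.asIdeal ≤ p.asIdeal)
    {Q : PrimeSpectrum (Localization.AtPrime p.asIdeal)}
    (hQ : Q.comap (algebraMap R (Localization.AtPrime p.asIdeal)) = q) :
    Q ∈ Module.support (Localization.AtPrime p.asIdeal)
      (LocalizedModule p.asIdeal.primeCompl M) := by
  rw [Module.mem_support_iff'] at hq ⊢
  obtain ⟨m, hm⟩ := hq
  refine ⟨LocalizedModule.mkLinearMap p.asIdeal.primeCompl M m, fun z hz h0 => ?_⟩
  obtain ⟨t, s, rfl⟩ := IsLocalization.exists_mk'_eq p.asIdeal.primeCompl z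
  have ht : t ∉ q.asIdeal := by
    intro ht
    rw [← hQ] at ht
    refine hz ?_
    rw [IsLocalization.mk'_eq_mul_mk'_one]
    exact Ideal.mul_mem_right _ _ ht
  have h1 : algebraMap R (Localization.AtPrime p.asIdeal) t •
      LocalizedModule.mkLinearMap p.asIdeal.primeCompl M m = 0 := by
    rw [← IsLocalization.mk'_spec _ t s, mul_comm, mul_smul, h0, smul_zero]
  rw [algebraMap_smul, ← map_smul, IsLocalizedModule.eq_zero_iff p.asIdeal.primeCompl] at h1
  obtain ⟨u, hu⟩ := h1
  refine hm (u * t) (fun hc => ?_) (by rw [mul_smul]; exact hu)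
  exact (q.isPrime.mem_or_mem hc).elim (fun h => u.2 (hqp h)) ht

theorem koszulGradeSeq_le_height [Module.Finite R M] (p : Module.support R M) (x : Fin r → R)
    (hx : ∀ j, x j ∈ p.1.asIdeal) : koszulGradeSeq M x ≤ Order.height p := by
  cases hd : Order.height p with
  | top => exact le_top
  | coe d =>
    have : Nontrivial (LocalizedModule p.1.asIdeal.primeCompl M) := Module.mem_support_iff.mp p.2
    refine (koszulGradeSeq_le_localization p.1.asIdeal x).trans
      (koszulGradeSeq_le_of_chainsLE (fun c hc => ?_) _ fun j => ?_)
    · let c' : LTSeries (Module.support R M) :=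
        { length := c.length
          toFun i := ⟨(c i).comap (algebraMap R (Localization.AtPrime p.1.asIdeal)),
            comap_mem_support_of_mem_support p.1.asIdeal (hc.trans (c.monotone (Fin.zero_le i)))⟩
          step i := comap_localization_strictMono p.1.asIdeal (c.step i) }
      have hlast : c'.last ≤ p := by
        intro t ht
        by_contra htp
        exact c.last.isPrime.ne_top (Ideal.eq_top_of_isUnit_mem _ ht
          (IsLocalization.map_units (Localization.AtPrime p.1.asIdeal)
            (⟨t, htp⟩ : p.1.asIdeal.primeCompl)))
      have := Order.length_le_height hlast
      rw [hd] at this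
      exact_mod_cast this
    · rw [← Localization.AtPrime.map_eq_maximalIdeal]
      exact Ideal.mem_map_of_mem _ (hx j)

theorem koszulGrade_le_moduleHeight [Module.Finite R M] (a : Ideal R) :
    koszulGrade a M ≤ moduleHeight M a :=
  iSup_le fun _ => iSup₂_le fun x hx => le_iInf₂ fun p hp =>
    koszulGradeSeq_le_height p x fun j => hp (hx j)

theorem moduleHeight_le_height {a : Ideal R} (p : Module.support R M) (h : a ≤ p.1.asIdeal) :
    moduleHeight M a ≤ Order.height p :=
  iInf₂_le p h

theorem moduleHeight_eq_height (p : Module.support R M) :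
    moduleHeight M p.1.asIdeal = Order.height p :=
  le_antisymm (moduleHeight_le_height p le_rfl) (le_iInf₂ fun _ hq => Order.height_mono hq)

theorem le_koszulGrade {a : Ideal R} (x : Fin r → R) (hx : ∀ j, x j ∈ a) :
    koszulGradeSeq M x ≤ koszulGrade a M :=
  le_iSup_of_le r (le_iSup₂_of_le x hx le_rfl)

theorem koszulGrade_le {a : Ideal R} {g : ℕ∞}
    (h : ∀ (r : ℕ) (x : Fin r → R), (∀ j, x j ∈ a) → koszulGradeSeq M x ≤ g) :
    koszulGrade a M ≤ g :=
  iSup_le fun r => iSup₂_le fun x hx => h r x hx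

theorem exists_lt_koszulGradeSeq {a : Ideal R} {g : ℕ∞} (h : ¬ koszulGrade a M ≤ g) :
    ∃ (r : ℕ) (x : Fin r → R), (∀ j, x j ∈ a) ∧ g < koszulGradeSeq M x := by
  by_contra! hc
  exact h (koszulGrade_le hc)

theorem koszulGrade_sSup_le {c : Set (Ideal R)} (hc : IsChain (· ≤ ·) c) (hne : c.Nonempty)
    {g : ℕ∞} (h : ∀ b ∈ c, koszulGrade b M ≤ g) : koszulGrade (sSup c) M ≤ g := by
  refine koszulGrade_le fun r x hx => ?_
  have hfg : (Ideal.span (Set.range x)).FG := Submodule.fg_span (Set.finite_range x)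
  obtain ⟨b, hb, hle⟩ := (CompleteLattice.isCompactElement_iff_le_of_directed_sSup_le _ _).mp
    ((Submodule.fg_iff_compact _).mp hfg) c hne hc.directedOn (Ideal.span_le.mpr (by
      rintro _ ⟨j, rfl⟩
      exact hx j))
  exact (le_koszulGrade x fun j => hle (Ideal.subset_span ⟨j, rfl⟩)).trans (h b hb)

/-- An ideal of finite Koszul grade is contained in a prime of the support of no larger grade. -/
theorem exists_prime_koszulGrade_le [Module.Finite R M] {a : Ideal R} {g : ℕ}
    (h : koszulGrade a M ≤ g) :
    ∃ p ∈ Module.support R M, a ≤ p.asIdeal ∧ koszulGrade p.asIdeal M ≤ g := by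
  -- Zorn applies because a finite sequence in the union of a chain already lies in one member.
  obtain ⟨p, hap, hp⟩ := zorn_le_nonempty₀ {b : Ideal R | koszulGrade b M ≤ g}
    (fun c hcs hc b hb => ⟨sSup c, koszulGrade_sSup_le hc ⟨b, hb⟩ hcs, fun _ hz => le_sSup hz⟩)
    a h
  have hpg : koszulGrade p M ≤ g := hp.1
  have hext : ∀ u ∉ p, ∃ (r : ℕ) (x : Fin r → R),
      (∀ j, x j ∈ p ⊔ Ideal.span {u}) ∧ (g : ℕ∞) < koszulGradeSeq M x := by
    intro u hu
    refine exists_lt_koszulGradeSeq fun hc => hu ?_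
    exact hp.2 hc le_sup_left (Ideal.mem_sup_right (Ideal.mem_span_singleton_self u))
  have hprime : p.IsPrime := by
    refine ⟨?_, fun {u v} huv => ?_⟩
    · rintro rfl
      have h1 := le_koszulGrade (M := M) (a := ⊤) (fun _ : Fin 1 => (1 : R))
        fun _ => Submodule.mem_top
      rw [koszulGradeSeq_eq_top_of_span_eq_top (by simp)] at h1
      exact absurd (h1.trans hpg) (by simp)
    · by_contra! hc
      obtain ⟨r, b, hb, hbg⟩ := hext u hc.1
      obtain ⟨m, c, hc, hcg⟩ := hext v hc.2
      -- By maximality `p + (u)` and `p + (v)` contain sequences of grade above `g`; their pairwise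
      -- products lie in `p` and would again have grade above `g`.
      let y : Fin (r * m) → R := fun k =>
        b (finProdFinEquiv.symm k).1 * c (finProdFinEquiv.symm k).2
      have hle : (p ⊔ Ideal.span {u}) * (p ⊔ Ideal.span {v}) ≤ p := by
        rw [Ideal.sup_mul, Ideal.mul_sup (Ideal.span {u}),
          Ideal.span_singleton_mul_span_singleton]
        exact sup_le Ideal.mul_le_left
          (sup_le Ideal.mul_le_right ((Ideal.span_singleton_le_iff_mem p).mpr huv))
      have hyp : ∀ k, y k ∈ p := fun k => hle (Ideal.mul_mem_mul (hb _) (hc _))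
      have h1 := min_koszulGradeSeq_le (M := M) y b c fun i j =>
        Ideal.subset_span ⟨finProdFinEquiv (i, j), by simp only [y, Equiv.symm_apply_apply]⟩
      exact absurd ((lt_min hbg hcg).trans_le h1)
        (not_lt.mpr ((le_koszulGrade y hyp).trans hpg))
  refine ⟨⟨p, hprime⟩, ?_, hap, hpg⟩
  rw [Module.mem_support_iff_of_finite]
  intro s hs
  by_contra hsp
  -- Adding an annihilator element cannot raise the grade: the `p`-components `z` of `y` have grade
  -- at least that of `y`.
  obtain ⟨r, y, hy, hyg⟩ := hext s hsp
  choose z hz w hw hzw using fun j => Submodule.mem_sup.mp (hy j)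
  refine absurd (hyg.trans_le (koszulGradeSeq_le_of_mem_radical z y fun j => ?_))
    (not_lt.mpr ((le_koszulGrade z hz).trans hpg))
  rw [← hzw j]
  refine Ideal.le_radical (add_mem (Ideal.mem_sup_left (Ideal.subset_span ⟨j, rfl⟩))
    (Ideal.mem_sup_right ?_))
  obtain ⟨t, ht⟩ := Ideal.mem_span_singleton'.mp (hw j)
  rw [← ht]
  exact Ideal.mul_mem_left _ _ hs

end Height

/-! ### The implications -/

section Main

variable {R : Type u} [CommRing R] {M : Type v} [AddCommGroup M] [Module R M] [Module.Finite R M]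

theorem IsCMSpec.isCMIdeals (h : IsCMSpec R M) : IsCMIdeals R M := by
  intro a
  refine le_antisymm ?_ (koszulGrade_le_moduleHeight a)
  cases hg : koszulGrade a M with
  | top => exact le_top
  | coe g =>
    obtain ⟨p, hp, hap, hpg⟩ := exists_prime_koszulGrade_le hg.le
    rw [← h p hp, moduleHeight_eq_height ⟨p, hp⟩] at hpg
    exact (moduleHeight_le_height ⟨p, hp⟩ hap).trans hpg

/-- `ht_M(q)` equals the grade of `q`, which is at most the grade of `qR_p`, which is at most the
`M_p`-height of `qR_p`. Contracting chains of primes bounds the latter by `ht_M(q)`, closing the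
circle. -/
theorem IsCMIdeals.isCMLocal (h : IsCMIdeals R M) : IsCMLocal R M := by
  intro p hp q hq hqp
  refine le_antisymm ?_ ?_
  · rw [h]
    exact koszulGrade_le fun r x hx => (koszulGradeSeq_le_localization p.asIdeal x).trans
      (le_koszulGrade _ fun j => Ideal.mem_map_of_mem _ (hx j))
  · refine (koszulGrade_le_moduleHeight _).trans ?_
    let S := Localization.AtPrime p.asIdeal
    have hdisj : Disjoint (p.asIdeal.primeCompl : Set R) q.asIdeal :=
      Set.disjoint_left.mpr fun t ht ht' => ht (hqp ht')
    let Q : PrimeSpectrum S := ⟨q.asIdeal.map (algebraMap R S),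
      IsLocalization.isPrime_of_isPrime_disjoint p.asIdeal.primeCompl S _ q.isPrime hdisj⟩
    have hQ : Q.comap (algebraMap R S) = q := PrimeSpectrum.ext
      (IsLocalization.under_map_of_isPrime_disjoint p.asIdeal.primeCompl S q.isPrime hdisj)
    let f : Module.support S (LocalizedModule p.asIdeal.primeCompl M) → Module.support R M :=
      fun P => ⟨P.1.comap (algebraMap R S), comap_mem_support_of_mem_support p.asIdeal
        (Module.annihilator_le_of_mem_support P.2)⟩
    have hf : StrictMono f := fun _ _ hPQ => comap_localization_strictMono p.asIdeal hPQ
    let Q' : Module.support S (LocalizedModule p.asIdeal.primeCompl M) :=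
      ⟨Q, map_mem_support_localization hq hqp hQ⟩
    have hfQ : f Q' = ⟨q, hq⟩ := Subtype.ext hQ
    rw [moduleHeight_eq_height ⟨q, hq⟩, ← hfQ]
    exact (moduleHeight_eq_height Q').le.trans
      (Order.height_le_height_apply_of_strictMono f hf Q')

theorem IsCMGlaz.isCMFGIdeals (h : IsCMGlaz R M) : IsCMFGIdeals R M := by
  intro a ha
  refine le_antisymm ?_ (koszulGrade_le_moduleHeight a)
  obtain ⟨r, x, rfl⟩ := Submodule.fg_iff_exists_fin_generating_family.mp ha
  refine le_trans ?_ (le_koszulGrade x fun j => Submodule.subset_span ⟨j, rfl⟩)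
  cases hg : koszulGradeSeq M x with
  | top => exact le_top
  | coe g =>
    obtain ⟨F, hF, hFB, hT⟩ := exists_hasNilpotentClass hg
    have hne : koszulColon x F ≠ ⊤ := by
      intro hc
      have h1 : (1 : R) ∈ koszulColon x F := hc ▸ Submodule.mem_top
      exact hFB (by simpa [mem_koszulColon] using h1)
    obtain ⟨m, hm, hle⟩ := Ideal.exists_le_maximal _ hne
    -- This `p` contains the sequence and the annihilator of `M`, and the grade of `pR_p` is at most
    -- `g` because `pR_p` acts nilpotently on the localized class.
    obtain ⟨p, hp, -⟩ := Ideal.exists_minimalPrimes_le (J := m) hle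
    have hpp : p.IsPrime := hp.1.1
    have hpS : (⟨p, hpp⟩ : PrimeSpectrum R) ∈ Module.support R M :=
      Module.mem_support_iff_of_finite.mpr (annihilator_le_koszulColon.trans hp.1.2)
    have hxp : Ideal.span (Set.range x) ≤ p := (span_le_koszulColon hF).trans hp.1.2
    have h1 : moduleHeight M (Ideal.span (Set.range x)) ≤ moduleHeight M p :=
      (moduleHeight_le_height ⟨⟨p, hpp⟩, hpS⟩ hxp).trans (moduleHeight_eq_height ⟨⟨p, hpp⟩, hpS⟩).ge
    refine h1.trans ?_
    rw [h _ hpS]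
    exact koszulGrade_le fun s y hy =>
      (hasNilpotentClass_localization hT.1 hF hp).koszulGradeSeq_le y hy

end Main

end

theorem theorem3p3 (R : Type u) [CommRing R] (M : Type v) [AddCommGroup M] [Module R M]
    [Module.Finite R M] :
    (IsCMSpec R M ↔ IsCMIdeals R M) ∧
    (IsCMIdeals R M → IsCMLocal R M) ∧
    (IsCMLocal R M → IsCMGlaz R M) ∧
    (IsCMGlaz R M → IsCMFGIdeals R M) :=
  ⟨⟨IsCMSpec.isCMIdeals, fun h p _ => h p.asIdeal⟩, IsCMIdeals.isCMLocal, fun h p hp => h p hp p hp le_rfl,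
    IsCMGlaz.isCMFGIdeals⟩
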